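/- Let $d \ge 1$, let $A \in \mathbb{R}^{d\times d}$ be symmetric, $b \in \mathbb{R}^d$, $R > 0$, let $\|\cdot\|$ be the Euclidean norm and put $f(x) = \tfrac12 x^T A x + b^T x$. Let $\lambda_{\min}$ and $\lambda_{\max}$ be the smallest and largest eigenvalues of $A$, let $v_{\min}$ be any unit eigenvector of $A$ with eigenvalue $\lambda_{\min}$, and put $b^{(1)} = v_{\min}^T b$. Let $s_{\mathrm{tr}}$ be any solution of the trust-region problem, that is, a minimizer of $f$ over $\{x : \|x\| \le R\}$. Then there is exactly one real number $\lambda_{\mathrm{tr}}$ (the Lagrange multiplier) such that $$(A + \lambda_{\mathrm{tr}} I)s_{\mathrm{tr}} + b = 0, \qquad \lambda_{\mathrm{tr}} \ge \max\{-\lambda_{\min}, 0\}, \qquad \lambda_{\mathrm{tr}}(R - \|s_{\mathrm{tr}}\|) = 0.$$ For every integer $t \ge 1$, let $x_t$ be any Krylov-subspace solution of order $t$, that is, a minimizer of $f$ over $\{x \in \mathcal{K}_t(A,b) : \|x\| \le R\}$, where $\mathcal{K}_t(A,b) = \mathrm{span}\{b, Ab, \dots, A^{t-1}b\}$. Then $$f(x_t)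 - f(s_{\mathrm{tr}}) \le 36\,[f(0) - f(s_{\mathrm{tr}})]\,\exp\left(-4t\sqrt{\frac{\lambda_{\min}+\lambda_{\mathrm{tr}}}{\lambda_{\max}+\lambda_{\mathrm{tr}}}}\right),$$ where the quotient is read as $0$ if $\lambda_{\max}+\lambda_{\mathrm{tr}} = 0$. Moreover, if $\lambda_{\min} \ge 0$ or $b^{(1)} \neq 0$, then $$f(x_t) - f(s_{\mathrm{tr}}) \le \frac{(\lambda_{\max}-\lambda_{\min})\|s_{\mathrm{tr}}\|^2}{(t-\frac12)^2}\left[4 + \frac{\mathbf{1}\{\lambda_{\min}<0\}}{8}\,\log^2\left(\frac{4\|b\|^2}{(b^{(1)})^2}\right)\right],$$ where the logarithmic term is absent (equal to $0$) if $\lambda_{\min} \ge 0$. -/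

import Mathlib

noncomputable section

/-- The quadratic objective `x ↦ ½ xᵀ A x + bᵀ x` on Euclidean space. -/
def quadObj {d : ℕ} (A : Matrix (Fin d) (Fin d) ℝ) (b x : EuclideanSpace ℝ (Fin d)) : ℝ :=
  1 / 2 * inner ℝ x (A.toEuclideanLin x) + inner ℝ b x

/-- The Krylov subspace of order `t`, spanned by `b, A b, …, A ^ (t - 1) b`. -/
def krylovSpace {d : ℕ} (A : Matrix (Fin d) (Fin d) ℝ) (b : EuclideanSpace ℝ (Fin d)) (t : ℕ) :
    Submodule ℝ (EuclideanSpace ℝ (Fin d)) :=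
  Submodule.span ℝ {x | ∃ i : ℕ, i < t ∧ x = (A ^ i).toEuclideanLin b}

/-- The smallest eigenvalue (for symmetric `A` and `0 < d` the real spectrum is finite and
nonempty). -/
def lambdaMin {d : ℕ} (A : Matrix (Fin d) (Fin d) ℝ) : ℝ := sInf (spectrum ℝ A)

/-- The largest eigenvalue. -/
def lambdaMax {d : ℕ} (A : Matrix (Fin d) (Fin d) ℝ) : ℝ := sSup (spectrum ℝ A)

/-- `x` minimizes `g` over the set `S`. -/
def IsMinimizer {d : ℕ} (g : EuclideanSpace ℝ (Fin d) → ℝ) (S : Set (EuclideanSpace ℝ (Fin d)))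
    (x : EuclideanSpace ℝ (Fin d)) : Prop :=
  x ∈ S ∧ IsMinOn g S x

/-- `s` solves the trust-region problem: minimize `quadObj A b x` subject to `‖x‖ ≤ R`. -/
def IsTRSolution {d : ℕ} (A : Matrix (Fin d) (Fin d) ℝ) (b : EuclideanSpace ℝ (Fin d)) (R : ℝ)
    (s : EuclideanSpace ℝ (Fin d)) : Prop :=
  IsMinimizer (quadObj A b) {x | ‖x‖ ≤ R} s

/-- `x` is an order `t` Krylov subspace solution of the trust-region problem. -/
def IsKrylovTRSolution {d : ℕ} (A : Matrix (Fin d) (Fin d) ℝ) (b : EuclideanSpace ℝ (Fin d))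
    (R : ℝ) (t : ℕ) (x : EuclideanSpace ℝ (Fin d)) : Prop :=
  IsMinimizer (quadObj A b) {y | y ∈ krylovSpace A b t ∧ ‖y‖ ≤ R} x

/-- `lam` is the Lagrange multiplier (dual parameter) of the trust-region problem at `s`. -/
def IsTRMultiplier {d : ℕ} (A : Matrix (Fin d) (Fin d) ℝ) (b : EuclideanSpace ℝ (Fin d)) (R : ℝ)
    (s : EuclideanSpace ℝ (Fin d)) (lam : ℝ) : Prop :=
  A.toEuclideanLin s + lam • s + b = 0 ∧ max (-lambdaMin A) 0 ≤ lam ∧ lam * (R - ‖s‖) = 0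

end

/- Shifting `A` by the multiplier `λ`, or by `-λ_min`, makes it positive semidefinite and changes
neither the Krylov subspaces nor, at points of norm `‖s‖`, the suboptimality gap. It is therefore
enough to find one point of the Krylov subspace, of norm `‖s‖` (or at most `‖s‖` if `λ_min ≥ 0`),
whose gap for the shifted quadratic is small.

For the linear rate, `s = -(A + λ)⁻¹ b`, and a rescaled Chebyshev polynomial `q` with `q(0) = 1`
gives the Krylov point `s - q(A + λ) s`, which is then rescaled to the norm of `s`. For the
sublinear rate, projected accelerated gradient descent stays inside the Krylov subspaces and gives
a point of the ball at rate `1 / t²`. If `λ_min < 0` that point is moved to the sphere along a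
Krylov vector `z` which nearly minimizes the Rayleigh quotient; `z` exists because `b` is not
orthogonal to `v_min`, and its quality again comes from Chebyshev polynomials, through
`(1 - X) (U_n + U_{n-1})² = 1 - T_{2n+1}`. -/

section Chebyshev

open Polynomial Chebyshev

theorem one_sub_X_mul_U_add_U_sq (R : Type*) [CommRing R] (n : ℤ) :
    (1 - X) * (U R n + U R (n - 1)) ^ 2 = 1 - T R (2 * n + 1) := by
  have hU : U R (n - 1) ^ 2 + U R n ^ 2 - 2 * X * U R (n - 1) * U R n = 1 := by
    have hS := congrArg (fun p : R[X] => p.comp (2 * X)) (S_sq_add_S_sq R (n - 1))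
    simpa only [sub_comp, add_comp, mul_comp, pow_comp, X_comp, one_comp, S_comp_two_mul_X,
      sub_add_cancel] using hS
  have hTT : 2 * (X * U R n - U R (n - 1)) * (U R n - X * U R (n - 1)) = T R (2 * n + 1) + X := by
    have hT : T R (n + 1) = X * U R n - U R (n - 1) := by
      simpa [show n - 1 + 2 = n + 1 by ring] using T_eq_X_mul_U_sub_U R (n - 1)
    rw [← hT, ← T_eq_U_sub_X_mul_U, T_mul_T, add_sub_cancel_left, T_one, add_right_comm, ← two_mul]
  linear_combination (1 + X) * hU - hTT

theorem le_artanh {r : ℝ} (hr0 : 0 ≤ r) (hr1 : r < 1) : r ≤ Real.artanh r := by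
  have hlog : 2 * r ≤ Real.log (1 + r) - Real.log (1 - r) := by
    have hs := Real.hasSum_log_sub_log_of_abs_lt_one (by rwa [abs_of_nonneg hr0])
    simpa using le_hasSum hs 0 fun k _ => by positivity
  rw [Real.artanh_eq_half_log ⟨by linarith, hr1.le⟩, Real.log_div (by linarith) (by linarith)]
  linarith

theorem cosh_two_mul_artanh {r : ℝ} (hr : r ∈ Set.Ioo (-1) 1) :
    Real.cosh (2 * Real.artanh r) = (1 + r ^ 2) / (1 - r ^ 2) := by
  have h : 0 < 1 - r ^ 2 := by nlinarith [hr.1, hr.2]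
  rw [Real.cosh_two_mul, Real.cosh_artanh hr, Real.sinh_artanh hr, div_pow, div_pow,
    Real.sq_sqrt h.le, one_pow, ← add_div]

theorem half_exp_le_eval_T {l L : ℝ} (hl : 0 ≤ l) (hlL : l < L) (n : ℕ) :
    Real.exp (2 * n * √(l / L)) / 2 ≤ (T ℝ n).eval ((L + l) / (L - l)) := by
  have hL : 0 < L := hl.trans_lt hlL
  have hr0 : 0 ≤ √(l / L) := Real.sqrt_nonneg _
  have hr1 : √(l / L) < 1 := by rwa [Real.sqrt_lt' one_pos, one_pow, div_lt_one hL]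
  have hcosh : Real.cosh (2 * Real.artanh √(l / L)) = (L + l) / (L - l) := by
    rw [cosh_two_mul_artanh ⟨by linarith, hr1⟩, Real.sq_sqrt (by positivity),
      one_add_div hL.ne', one_sub_div hL.ne', div_div_div_cancel_right₀ hL.ne']
  rw [← hcosh, T_real_cosh, Real.cosh_eq]
  have hexp : Real.exp (2 * n * √(l / L)) ≤
      Real.exp ((n : ℤ) * (2 * Real.artanh √(l / L))) := by
    rw [Int.cast_natCast, mul_comm (2 : ℝ), mul_assoc]
    gcongr
    exact le_artanh hr0 hr1
  linarith [Real.exp_pos (-((n : ℤ) * (2 * Real.artanh √(l / L))))]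

/-- The affine polynomial mapping `[l, L]` onto `[-1, 1]` with reversed orientation, so that `0`
is sent to `(L + l) / (L - l)`, the argument at which `half_exp_le_eval_T` bounds `T` below. -/
noncomputable def intervalFlip (l L : ℝ) : ℝ[X] :=
  C ((L + l) / (L - l)) - C (2 / (L - l)) * X

theorem eval_intervalFlip (l L z : ℝ) :
    (intervalFlip l L).eval z = (L + l - 2 * z) / (L - l) := by
  simp only [intervalFlip, eval_sub, eval_C, eval_mul, eval_X]
  ring

theorem abs_eval_intervalFlip_le_one {l L z : ℝ} (hlL : l < L) (hz : z ∈ Set.Icc l L) :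
    |(intervalFlip l L).eval z| ≤ 1 := by
  have hd : 0 < L - l := sub_pos.mpr hlL
  rw [eval_intervalFlip, abs_le, le_div_iff₀ hd, div_le_iff₀ hd]
  constructor <;> linarith [hz.1, hz.2]

theorem natDegree_comp_intervalFlip_le (p : ℝ[X]) (l L : ℝ) :
    (p.comp (intervalFlip l L)).natDegree ≤ p.natDegree := by
  have hdeg : (intervalFlip l L).natDegree ≤ 1 := by
    unfold intervalFlip
    compute_degree
  exact natDegree_comp_le.trans (by nlinarith)

theorem exists_eval_zero_eq_one_abs_eval_le {l L : ℝ} (hl : 0 < l) (hlL : l ≤ L) {t : ℕ}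
    (ht : 0 < t) :
    ∃ q : ℝ[X], q.natDegree ≤ t ∧ q.eval 0 = 1 ∧
      ∀ z ∈ Set.Icc l L, |q.eval z| ≤ 2 * Real.exp (-2 * t * √(l / L)) := by
  rcases hlL.eq_or_lt with rfl | hlt
  · refine ⟨1 - C l⁻¹ * X, by compute_degree; omega, by simp, fun z hz => ?_⟩
    obtain rfl : z = l := le_antisymm hz.2 hz.1
    simp only [eval_sub, eval_one, eval_mul, eval_C, eval_X, inv_mul_cancel₀ hl.ne', sub_self,
      abs_zero]
    positivity
  set τ := (T ℝ t).eval ((L + l) / (L - l))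
  have hT : Real.exp (2 * t * √(l / L)) / 2 ≤ τ := half_exp_le_eval_T hl.le hlt t
  have hτ : 0 < τ := (by positivity : 0 < Real.exp (2 * t * √(l / L)) / 2).trans_le hT
  refine ⟨C τ⁻¹ * (T ℝ t).comp (intervalFlip l L), ?_, ?_, fun z hz => ?_⟩
  · refine (natDegree_C_mul_le _ _).trans ((natDegree_comp_intervalFlip_le _ _ _).trans ?_)
    rw [natDegree_T, Int.natAbs_natCast]
  · rw [eval_mul, eval_C, eval_comp, eval_intervalFlip, mul_zero, sub_zero,
      inv_mul_cancel₀ hτ.ne']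
  · have hz1 := abs_eval_T_real_le_one t (abs_eval_intervalFlip_le_one hlt hz)
    rw [eval_mul, eval_C, eval_comp, abs_mul, abs_of_pos (inv_pos.mpr hτ)]
    calc τ⁻¹ * |(T ℝ t).eval ((intervalFlip l L).eval z)| ≤ τ⁻¹ * 1 := by gcongr
      _ ≤ (Real.exp (2 * t * √(l / L)) / 2)⁻¹ := by rw [mul_one]; gcongr
      _ = 2 * Real.exp (-2 * t * √(l / L)) := by
        rw [inv_div, div_eq_mul_inv, ← Real.exp_neg, neg_mul, neg_mul]

theorem exists_sub_mul_eval_sq_le {δ L τ : ℝ} (hδL : δ < L) (n : ℕ)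
    (hτ : τ ≤ (T ℝ (2 * n + 1)).eval ((L + δ) / (L - δ))) :
    ∃ P : ℝ[X], P.natDegree ≤ n ∧ -δ * P.eval 0 ^ 2 ≤ (L - δ) / 2 * (1 - τ) ∧
      ∀ z ∈ Set.Icc 0 L, (z - δ) * P.eval z ^ 2 ≤ L - δ := by
  have hd : 0 < L - δ := sub_pos.mpr hδL
  set P : ℝ[X] := (U ℝ n + U ℝ (n - 1)).comp (intervalFlip δ L)
  have hP (z : ℝ) : (z - δ) * P.eval z ^ 2 =
      (L - δ) / 2 * (1 - (T ℝ (2 * n + 1)).eval ((intervalFlip δ L).eval z)) := by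
    have h := congrArg (eval ((intervalFlip δ L).eval z)) (one_sub_X_mul_U_add_U_sq ℝ n)
    simp only [eval_sub, eval_mul, eval_one, eval_X, eval_pow] at h
    rw [← h, eval_comp, eval_intervalFlip]
    field_simp
    ring
  refine ⟨P, (natDegree_comp_intervalFlip_le _ _ _).trans ?_, ?_, fun z hz => ?_⟩
  · refine (natDegree_add_le _ _).trans (max_le (by simp) ?_)
    cases n <;> simp
  · have h0 := hP 0
    rw [eval_intervalFlip, mul_zero, sub_zero, zero_sub] at h0
    rw [h0]
    gcongr
  · rcases le_total z δ with hzδ | hzδ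
    · exact (mul_nonpos_of_nonpos_of_nonneg (by linarith) (sq_nonneg _)).trans hd.le
    · have hT := abs_le.mp <| abs_eval_T_real_le_one (2 * n + 1)
        (abs_eval_intervalFlip_le_one hδL ⟨hzδ, hz.2⟩)
      rw [hP]
      nlinarith [hT.1]

end Chebyshev

section Spectral

open Polynomial
open scoped RealInnerProductSpace

variable {E : Type*} [NormedAddCommGroup E] [InnerProductSpace ℝ E]

/-- The symmetric operator `T` has its quadratic form between `l` and `L` times the squared norm.
This replaces the smallest and largest eigenvalues when the space need not be
finite-dimensional. -/
structure HasSpectralBounds (T : E →ₗ[ℝ] E) (l L : ℝ) : Prop where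
  isSymmetric : T.IsSymmetric
  lower (x : E) : l * ‖x‖ ^ 2 ≤ ⟪x, T x⟫
  upper (x : E) : ⟪x, T x⟫ ≤ L * ‖x‖ ^ 2

/-- The operator `T + c`, used to make `T` positive semidefinite. -/
def shift (T : E →ₗ[ℝ] E) (c : ℝ) : E →ₗ[ℝ] E := T + c • LinearMap.id

theorem shift_apply (T : E →ₗ[ℝ] E) (c : ℝ) (x : E) : shift T c x = T x + c • x := rfl

theorem inner_shift_apply (T : E →ₗ[ℝ] E) (c : ℝ) (x : E) :
    ⟪x, shift T c x⟫ = ⟪x, T x⟫ + c * ‖x‖ ^ 2 := by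
  rw [shift_apply, inner_add_right, real_inner_smul_right, real_inner_self_eq_norm_sq]

theorem hasSpectralBounds_shift {T : E →ₗ[ℝ] E} {l L : ℝ} (h : HasSpectralBounds T l L) (c : ℝ) :
    HasSpectralBounds (shift T c) (l + c) (L + c) where
  isSymmetric := h.isSymmetric.add (LinearMap.IsSymmetric.id.smul (by simp))
  lower x := by
    rw [inner_shift_apply]
    linarith [h.lower x]
  upper x := by
    rw [inner_shift_apply]
    linarith [h.upper x]

/-- The Krylov subspace of order `t` of an operator `T` and a vector `b`. -/
def krylov (T : E →ₗ[ℝ] E) (b : E) (t : ℕ) : Submodule ℝ E :=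
  Submodule.span ℝ {x | ∃ i < t, x = (T ^ i) b}

theorem krylov_mono (T : E →ₗ[ℝ] E) (b : E) : Monotone (krylov T b) := fun _ _ hmn =>
  Submodule.span_mono fun _ ⟨i, hi, hx⟩ => ⟨i, hi.trans_le hmn, hx⟩

theorem pow_apply_mem_krylov {T : E →ₗ[ℝ] E} {b : E} {i t : ℕ} (hi : i < t) :
    (T ^ i) b ∈ krylov T b t :=
  Submodule.subset_span ⟨i, hi, rfl⟩

theorem apply_mem_krylov_succ {T : E →ₗ[ℝ] E} {b x : E} {t : ℕ} (hx : x ∈ krylov T b t) :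
    T x ∈ krylov T b (t + 1) := by
  suffices krylov T b t ≤ (krylov T b (t + 1)).comap T from this hx
  refine Submodule.span_le.mpr ?_
  rintro _ ⟨i, hi, rfl⟩
  rw [SetLike.mem_coe, Submodule.mem_comap, ← Module.End.mul_apply, ← pow_succ']
  exact pow_apply_mem_krylov (by lia)

theorem aeval_mem_krylov (T : E →ₗ[ℝ] E) (b : E) {p : ℝ[X]} {t : ℕ} (hp : p.degree < t) :
    aeval T p b ∈ krylov T b t := by
  rw [aeval_eq_sum_range, LinearMap.sum_apply]
  refine Submodule.sum_mem _ fun i _ => ?_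
  rw [LinearMap.smul_apply]
  by_cases hi : i < t
  · exact Submodule.smul_mem _ _ (pow_apply_mem_krylov hi)
  · rw [coeff_eq_zero_of_degree_lt (hp.trans_le (by exact_mod_cast not_lt.mp hi)), zero_smul]
    exact Submodule.zero_mem _

theorem krylov_shift_le (T : E →ₗ[ℝ] E) (b : E) (c : ℝ) (t : ℕ) :
    krylov (shift T c) b t ≤ krylov T b t := by
  have hpow (i : ℕ) : (shift T c ^ i) b ∈ krylov T b (i + 1) := by
    induction i with
    | zero => exact pow_apply_mem_krylov one_pos
    | succ i ih =>
      rw [pow_succ', Module.End.mul_apply]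
      exact Submodule.add_mem _ (apply_mem_krylov_succ ih)
        (Submodule.smul_mem _ _ (krylov_mono T b (by lia) ih))
  refine Submodule.span_le.mpr ?_
  rintro _ ⟨i, hi, rfl⟩
  exact krylov_mono T b hi (hpow i)

theorem isSymmetric_aeval {T : E →ₗ[ℝ] E} (hT : T.IsSymmetric) (p : ℝ[X]) :
    (aeval T p).IsSymmetric := by
  induction p using Polynomial.induction_on' with
  | add p q hp hq =>
    rw [map_add]
    exact hp.add hq
  | monomial n a =>
    rw [aeval_monomial, Algebra.algebraMap_eq_smul_one, smul_mul_assoc, one_mul]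
    exact (hT.pow n).smul (by simp)

theorem inner_aeval_nonneg_of_forall_hasEigenvalue [FiniteDimensional ℝ E] {T : E →ₗ[ℝ] E}
    (hT : T.IsSymmetric) {p : ℝ[X]} (hp : ∀ μ, Module.End.HasEigenvalue T μ → 0 ≤ p.eval μ)
    (x : E) : 0 ≤ ⟪x, aeval T p x⟫ := by
  set u := hT.eigenvectorBasis rfl
  rw [← u.sum_inner_mul_inner]
  refine Finset.sum_nonneg fun i _ => ?_
  have hu : aeval T p (u i) = p.eval (hT.eigenvalues rfl i) • u i :=
    Module.End.aeval_apply_of_mem_apply_eq_smul (hT.apply_eigenvectorBasis rfl i)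
  rw [← isSymmetric_aeval hT p, hu, real_inner_smul_left, real_inner_comm]
  rw [mul_left_comm, ← sq]
  exact mul_nonneg (hp _ (hT.hasEigenvalue_eigenvalues rfl i)) (sq_nonneg _)

variable {T : E →ₗ[ℝ] E} {l L : ℝ}

theorem HasSpectralBounds.mem_Icc_of_hasEigenvalue (h : HasSpectralBounds T l L) {μ : ℝ}
    (hμ : Module.End.HasEigenvalue T μ) : μ ∈ Set.Icc l L := by
  obtain ⟨v, hv⟩ := hμ.exists_hasEigenvector
  have hv0 : 0 < ‖v‖ ^ 2 := by
    have := norm_pos_iff.mpr hv.2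
    positivity
  have hform : ⟪v, T v⟫ = μ * ‖v‖ ^ 2 := by
    rw [hv.apply_eq_smul, real_inner_smul_right, real_inner_self_eq_norm_sq]
  exact ⟨le_of_mul_le_mul_right (hform ▸ h.lower v) hv0,
    le_of_mul_le_mul_right (hform ▸ h.upper v) hv0⟩

/-- The orthogonal projection onto `V` of `T` restricted to `V`. -/
noncomputable def compression (T : E →ₗ[ℝ] E) (V : Submodule ℝ E) [V.HasOrthogonalProjection] :
    V →ₗ[ℝ] V :=
  V.orthogonalProjectionOnto.toLinearMap ∘ₗ T ∘ₗ V.subtype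

theorem hasSpectralBounds_compression (h : HasSpectralBounds T l L) (V : Submodule ℝ E)
    [V.HasOrthogonalProjection] : HasSpectralBounds (compression T V) l L where
  isSymmetric x y := by
    change ⟪V.orthogonalProjectionOnto (T x), y⟫ = ⟪x, V.orthogonalProjectionOnto (T y)⟫
    rw [Submodule.inner_orthogonalProjectionOnto_eq_of_mem_right,
      Submodule.inner_orthogonalProjectionOnto_eq_of_mem_left, h.isSymmetric]
  lower x := by
    change l * ‖x‖ ^ 2 ≤ ⟪x, V.orthogonalProjectionOnto (T x)⟫
    rw [Submodule.inner_orthogonalProjectionOnto_eq_of_mem_left]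
    exact h.lower x
  upper x := by
    change ⟪x, V.orthogonalProjectionOnto (T x)⟫ ≤ L * ‖x‖ ^ 2
    rw [Submodule.inner_orthogonalProjectionOnto_eq_of_mem_left]
    exact h.upper x

theorem coe_compression_pow_apply {V : Submodule ℝ E} [V.HasOrthogonalProjection] (x : V) {n : ℕ}
    (hV : ∀ i ≤ n, (T ^ i) (x : E) ∈ V) : ((compression T V ^ n) x : E) = (T ^ n) (x : E) := by
  induction n with
  | zero => rfl
  | succ n ih =>
    rw [pow_succ', Module.End.mul_apply]
    change (V.orthogonalProjectionOnto (T ↑((compression T V ^ n) x)) : E) = _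
    rw [ih fun i hi => hV i (by lia), ← Module.End.mul_apply, ← pow_succ']
    exact Submodule.starProjection_eq_self_iff.mpr (hV _ le_rfl)

instance finiteDimensional_krylov (T : E →ₗ[ℝ] E) (b : E) (t : ℕ) :
    FiniteDimensional ℝ (krylov T b t) := by
  refine FiniteDimensional.span_of_finite ℝ ?_
  refine ((Set.finite_lt_nat t).image fun i => (T ^ i) b).subset ?_
  rintro _ ⟨i, hi, rfl⟩
  exact ⟨i, hi, rfl⟩

/- Only finitely many powers of `T` act on `x`, so `T` may be replaced by its compression to a
Krylov subspace, which has an orthonormal basis of eigenvectors. -/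
theorem HasSpectralBounds.inner_aeval_nonneg (h : HasSpectralBounds T l L) {p : ℝ[X]}
    (hp : ∀ z ∈ Set.Icc l L, 0 ≤ p.eval z) (x : E) : 0 ≤ ⟪x, aeval T p x⟫ := by
  set V := krylov T x (p.natDegree + 1)
  set x' : V := ⟨x, pow_apply_mem_krylov (i := 0) (by lia)⟩
  have haeval : (aeval (compression T V) p x' : E) = aeval T p x := by
    rw [aeval_eq_sum_range, aeval_eq_sum_range, LinearMap.sum_apply, LinearMap.sum_apply,
      Submodule.coe_sum]
    refine Finset.sum_congr rfl fun i hi => ?_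
    rw [LinearMap.smul_apply, LinearMap.smul_apply, Submodule.coe_smul, coe_compression_pow_apply]
    exact fun j hj => pow_apply_mem_krylov (hj.trans_lt (Finset.mem_range.mp hi))
  have hV := hasSpectralBounds_compression h V
  rw [← haeval]
  exact inner_aeval_nonneg_of_forall_hasEigenvalue hV.isSymmetric
    (fun μ hμ => hp μ (hV.mem_Icc_of_hasEigenvalue hμ)) x'

theorem HasSpectralBounds.inner_aeval_mono (h : HasSpectralBounds T l L) {p q : ℝ[X]}
    (hpq : ∀ z ∈ Set.Icc l L, p.eval z ≤ q.eval z) (x : E) :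
    ⟪x, aeval T p x⟫ ≤ ⟪x, aeval T q x⟫ := by
  have hsub := h.inner_aeval_nonneg (p := q - p)
    (fun z hz => by simpa only [eval_sub, sub_nonneg] using hpq z hz) x
  rwa [map_sub, LinearMap.sub_apply, inner_sub_right, sub_nonneg] at hsub

theorem inner_aeval_mul_sq (hT : T.IsSymmetric) (p q : ℝ[X]) (x : E) :
    ⟪x, aeval T (p * q ^ 2) x⟫ = ⟪aeval T q x, aeval T p (aeval T q x)⟫ := by
  rw [isSymmetric_aeval hT q, ← Module.End.mul_apply, ← Module.End.mul_apply, ← map_mul, ← map_mul]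
  ring_nf

theorem HasSpectralBounds.norm_aeval_apply_le (h : HasSpectralBounds T l L) {q : ℝ[X]} {ε : ℝ}
    (hε : 0 ≤ ε) (hq : ∀ z ∈ Set.Icc l L, |q.eval z| ≤ ε) (x : E) :
    ‖aeval T q x‖ ≤ ε * ‖x‖ := by
  have hsq := h.inner_aeval_mono (p := 1 * q ^ 2) (q := C (ε ^ 2))
    (fun z hz => by
      simpa only [one_mul, eval_pow, eval_C] using
        sq_le_sq' (abs_le.mp (hq z hz)).1 (abs_le.mp (hq z hz)).2) x
  rw [inner_aeval_mul_sq h.isSymmetric, map_one, aeval_C, Module.End.one_apply,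
    Module.algebraMap_end_apply, real_inner_smul_right, real_inner_self_eq_norm_sq,
    real_inner_self_eq_norm_sq, ← mul_pow] at hsq
  exact (pow_le_pow_iff_left₀ (norm_nonneg _) (by positivity) two_ne_zero).mp hsq

end Spectral

section AcceleratedGradient

open scoped RealInnerProductSpace

variable {E : Type*} [NormedAddCommGroup E] [InnerProductSpace ℝ E] {T : E →ₗ[ℝ] E} {L : ℝ}

/-- The objective `x ↦ ½ ⟪x, T x⟫ + ⟪b, x⟫`; for symmetric `T` its gradient is `T x + b`. -/
noncomputable def quadraticModel (T : E →ₗ[ℝ] E) (b x : E) : ℝ :=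
  1 / 2 * ⟪x, T x⟫ + ⟪b, x⟫

theorem quadraticModel_shift (T : E →ₗ[ℝ] E) (c : ℝ) (b x : E) :
    quadraticModel (shift T c) b x = quadraticModel T b x + c / 2 * ‖x‖ ^ 2 := by
  rw [quadraticModel, quadraticModel, inner_shift_apply]
  ring

theorem quadraticModel_add (hT : T.IsSymmetric) (b x h : E) :
    quadraticModel T b (x + h) =
      quadraticModel T b x + ⟪T x + b, h⟫ + 1 / 2 * ⟪h, T h⟫ := by
  simp only [quadraticModel, map_add, inner_add_left, inner_add_right, hT x h,
    real_inner_comm (T x) h]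
  rw [← hT x h, real_inner_comm h]
  ring

theorem quadraticModel_sub_eq (hT : T.IsSymmetric) {b s : E} {lam : ℝ}
    (hs : T s + lam • s + b = 0) (x : E) :
    quadraticModel T b x - quadraticModel T b s =
      1 / 2 * ⟪x - s, shift T lam (x - s)⟫ + lam / 2 * (‖s‖ ^ 2 - ‖x‖ ^ 2) := by
  have hsym : (shift T lam).IsSymmetric := hT.add (LinearMap.IsSymmetric.id.smul (by simp))
  have h := quadraticModel_add hsym b s (x - s)
  rw [shift_apply T lam s, hs, inner_zero_left, add_sub_cancel, quadraticModel_shift,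
    quadraticModel_shift] at h
  linarith

theorem quadraticModel_add_inner_le (h : HasSpectralBounds T 0 L) (b x y : E) :
    quadraticModel T b x + ⟪T x + b, y - x⟫ ≤ quadraticModel T b y := by
  have hadd := quadraticModel_add h.isSymmetric b x (y - x)
  rw [add_sub_cancel] at hadd
  linarith [h.lower (y - x)]

theorem exists_smul_inner_sub_nonpos {R : ℝ} (hR : 0 ≤ R) (w : E) :
    ∃ c : ℝ, ‖c • w‖ ≤ R ∧ ∀ s : E, ‖s‖ ≤ R → ⟪w - c • w, s - c • w⟫ ≤ 0 := by
  rcases le_or_gt ‖w‖ R with hw | hw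
  · exact ⟨1, by rwa [one_smul], fun s _ => by rw [one_smul, sub_self, inner_zero_left]⟩
  have hw0 : 0 < ‖w‖ := hR.trans_lt hw
  have hc : R / ‖w‖ * ‖w‖ = R := div_mul_cancel₀ R hw0.ne'
  have hc1 : R / ‖w‖ ≤ 1 := (div_le_one hw0).mpr hw.le
  refine ⟨R / ‖w‖, ?_, fun s hs => ?_⟩
  · rw [norm_smul, Real.norm_of_nonneg (by positivity), hc]
  · have hws : ⟪w, s⟫ ≤ ‖w‖ * R := (real_inner_le_norm w s).trans (by gcongr)
    have hww : R / ‖w‖ * ‖w‖ ^ 2 = ‖w‖ * R := by rw [sq, ← mul_assoc, hc, mul_comm]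
    rw [show w - (R / ‖w‖) • w = (1 - R / ‖w‖) • w by rw [sub_smul, one_smul],
      real_inner_smul_left, inner_sub_right, real_inner_smul_right, real_inner_self_eq_norm_sq, hww]
    exact mul_nonpos_of_nonneg_of_nonpos (sub_nonneg.mpr hc1) (by linarith)

theorem exists_projected_step {R : ℝ} (hR : 0 ≤ R) (z g : E) :
    ∃ c : ℝ, ‖c • (z - g)‖ ≤ R ∧ ∀ s : E, ‖s‖ ≤ R →
      2 * ⟪g, c • (z - g) - s⟫ ≤
        ‖z - s‖ ^ 2 - ‖c • (z - g) - s‖ ^ 2 - ‖c • (z - g) - z‖ ^ 2 := by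
  obtain ⟨c, hc, hproj⟩ := exists_smul_inner_sub_nonpos hR (z - g)
  refine ⟨c, hc, fun s hs => ?_⟩
  set z' := c • (z - g)
  have hinner := hproj s hs
  have hnorm := norm_sub_sq_real (z' - z) (z' - s)
  rw [sub_sub_sub_cancel_left, norm_sub_rev s z] at hnorm
  rw [show z - g - z' = -(z' - z) - g by abel, inner_sub_left, inner_neg_left, ← neg_sub z' s,
    inner_neg_right, inner_neg_right] at hinner
  linarith

theorem accelerated_potential_le (h : HasSpectralBounds T 0 L) {b x z z' s : E} {B τ : ℝ}
    (hB : 0 ≤ B) (hτ : τ ∈ Set.Icc (0 : ℝ) 1) (hBτ : B * τ ^ 2 ≤ 1)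
    (hz' : B * τ * ⟪T ((1 - τ) • x + τ • z) + b, z' - s⟫ ≤
      L / 2 * (‖z - s‖ ^ 2 - ‖z' - s‖ ^ 2 - ‖z' - z‖ ^ 2)) :
    B * (quadraticModel T b ((1 - τ) • x + τ • z') - quadraticModel T b s) +
        L / 2 * ‖z' - s‖ ^ 2 ≤
      B * (1 - τ) * (quadraticModel T b x - quadraticModel T b s) + L / 2 * ‖z - s‖ ^ 2 := by
  set y := (1 - τ) • x + τ • z with hy
  set g := T y + b
  have hx' : quadraticModel T b ((1 - τ) • x + τ • z') =
      quadraticModel T b y + τ * ⟪g, z' - z⟫ + τ ^ 2 / 2 * ⟪z' - z, T (z' - z)⟫ := by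
    rw [show (1 - τ) • x + τ • z' = y + τ • (z' - z) by rw [hy]; module,
      quadraticModel_add h.isSymmetric, real_inner_smul_right, map_smul, real_inner_smul_left,
      real_inner_smul_right]
    ring
  have hconvex : quadraticModel T b y + τ * ⟪g, s - z⟫ ≤
      (1 - τ) * quadraticModel T b x + τ * quadraticModel T b s := by
    have hcomb : (1 - τ) * ⟪g, x - y⟫ + τ * ⟪g, s - y⟫ = τ * ⟪g, s - z⟫ := by
      simp only [hy, inner_sub_right, inner_add_right, real_inner_smul_right]
      ring
    have hx := mul_le_mul_of_nonneg_left (quadraticModel_add_inner_le h b y x)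
      (sub_nonneg.mpr hτ.2)
    have hs := mul_le_mul_of_nonneg_left (quadraticModel_add_inner_le h b y s) hτ.1
    linarith
  have hsmooth : B * τ ^ 2 * ⟪z' - z, T (z' - z)⟫ ≤ L * ‖z' - z‖ ^ 2 :=
    (mul_le_of_le_one_left (by simpa using h.lower (z' - z)) hBτ).trans (h.upper _)
  have hsplit : ⟪g, z' - z⟫ = ⟪g, z' - s⟫ + ⟪g, s - z⟫ := by
    rw [← inner_add_right, sub_add_sub_cancel]
  have hBconvex := mul_le_mul_of_nonneg_left hconvex hB
  rw [hx', hsplit]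
  linarith

theorem exists_accelerated_step_size (t : ℕ) :
    ∃ τ ∈ Set.Icc (0 : ℝ) 1, ((t : ℝ) + 1) ^ 2 / 4 * τ ^ 2 ≤ 1 ∧
      ((t : ℝ) + 1) ^ 2 / 4 * (1 - τ) = (t : ℝ) ^ 2 / 4 := by
  have ht : (0 : ℝ) < (t + 1) ^ 2 := by positivity
  refine ⟨(2 * t + 1) / ((t : ℝ) + 1) ^ 2, ⟨by positivity, (div_le_one ht).mpr ?_⟩, ?_, ?_⟩
  · nlinarith [Nat.cast_nonneg (α := ℝ) t]
  · rw [show ((t : ℝ) + 1) ^ 2 / 4 * ((2 * t + 1) / ((t : ℝ) + 1) ^ 2) ^ 2 =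
      (2 * t + 1) ^ 2 / (4 * (t + 1) ^ 2) by field_simp, div_le_one (by positivity)]
    nlinarith [Nat.cast_nonneg (α := ℝ) t]
  · field_simp
    ring

/- The left-hand side of the last inequality is the potential of accelerated gradient descent; it
does not increase with `t`. -/
theorem exists_accelerated_iterates (h : HasSpectralBounds T 0 L) (hL : 0 < L) (b s : E) (t : ℕ) :
    ∃ x ∈ krylov T b t, ∃ z ∈ krylov T b t, ‖x‖ ≤ ‖s‖ ∧
      (t : ℝ) ^ 2 / 4 * (quadraticModel T b x - quadraticModel T b s) + L / 2 * ‖z - s‖ ^ 2 ≤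
        L / 2 * ‖s‖ ^ 2 := by
  induction t with
  | zero => exact ⟨0, zero_mem _, 0, zero_mem _, by simp, by simp⟩
  | succ t ih =>
    obtain ⟨x, hxK, z, hzK, hx, hpot⟩ := ih
    obtain ⟨τ, hτ, hBτ, hB⟩ := exists_accelerated_step_size t
    set B : ℝ := ((t : ℝ) + 1) ^ 2 / 4
    set g := T ((1 - τ) • x + τ • z) + b
    obtain ⟨c, hc, hstep⟩ := exists_projected_step (norm_nonneg s) z ((B * τ / L) • g)
    set z' := c • (z - (B * τ / L) • g)
    have hgK : g ∈ krylov T b (t + 1) :=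
      add_mem (apply_mem_krylov_succ (add_mem (Submodule.smul_mem _ _ hxK)
        (Submodule.smul_mem _ _ hzK))) (pow_apply_mem_krylov t.succ_pos)
    have hmono := krylov_mono T b t.le_succ
    have hz'K : z' ∈ krylov T b (t + 1) :=
      Submodule.smul_mem _ _ (sub_mem (hmono hzK) (Submodule.smul_mem _ _ hgK))
    refine ⟨(1 - τ) • x + τ • z', add_mem (Submodule.smul_mem _ _ (hmono hxK))
      (Submodule.smul_mem _ _ hz'K), z', hz'K, ?_, ?_⟩
    · exact mem_closedBall_zero_iff.mp <| convex_closedBall (0 : E) ‖s‖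
        (mem_closedBall_zero_iff.mpr hx) (mem_closedBall_zero_iff.mpr hc)
        (sub_nonneg.mpr hτ.2) hτ.1 (sub_add_cancel 1 τ)
    · refine le_trans ?_ (hB.symm ▸ hpot)
      rw [Nat.cast_succ]
      refine accelerated_potential_le h (by positivity) hτ hBτ ?_
      have hs := mul_le_mul_of_nonneg_left (hstep s le_rfl) (by positivity : 0 ≤ L / 2)
      rwa [real_inner_smul_left, ← mul_assoc, ← mul_assoc, div_mul_cancel₀ _ two_ne_zero,
        mul_div_cancel₀ _ hL.ne'] at hs

theorem exists_smul_norm_le_inner_eq {r : ℝ} (hr : 0 ≤ r) (b : E) :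
    ∃ c : ℝ, ‖c • b‖ ≤ r ∧ ⟪b, c • b⟫ = -(‖b‖ * r) := by
  rcases eq_or_ne b 0 with rfl | hb
  · exact ⟨0, by simpa using hr, by simp⟩
  have hb' : ‖b‖ ≠ 0 := norm_ne_zero_iff.mpr hb
  refine ⟨-(r / ‖b‖), ?_, ?_⟩
  · rw [norm_smul, norm_neg, Real.norm_of_nonneg (by positivity), div_mul_cancel₀ _ hb']
  · rw [real_inner_smul_right, real_inner_self_eq_norm_sq]
    field_simp

theorem exists_ball_approx (h : HasSpectralBounds T 0 L) (hL : 0 ≤ L) (b s : E) {t : ℕ}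
    (ht : 0 < t) :
    ∃ x ∈ krylov T b t, ‖x‖ ≤ ‖s‖ ∧
      quadraticModel T b x - quadraticModel T b s ≤ 2 * L * ‖s‖ ^ 2 / (t : ℝ) ^ 2 := by
  rcases hL.eq_or_lt with rfl | hL
  · have hform (x : E) : quadraticModel T b x = ⟪b, x⟫ := by
      have := (h.lower x).antisymm (h.upper x)
      rw [quadraticModel, ← this, zero_mul, mul_zero, zero_add]
    obtain ⟨c, hc, hbc⟩ := exists_smul_norm_le_inner_eq (norm_nonneg s) b
    refine ⟨c • b, Submodule.smul_mem _ _ (pow_apply_mem_krylov (i := 0) ht), hc, ?_⟩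
    rw [hform, hform, hbc, mul_zero, zero_mul, zero_div]
    linarith [neg_le_of_abs_le (abs_real_inner_le_norm b s)]
  · obtain ⟨x, hx, z, -, hxs, hpot⟩ := exists_accelerated_iterates h hL b s t
    refine ⟨x, hx, hxs, ?_⟩
    rw [le_div_iff₀ (by positivity)]
    have := mul_nonneg hL.le (sq_nonneg ‖z - s‖)
    linarith

end AcceleratedGradient

section LinearRate

open Polynomial
open scoped RealInnerProductSpace

variable {E : Type*} [NormedAddCommGroup E] [InnerProductSpace ℝ E] {T : E →ₗ[ℝ] E} {l L : ℝ}

theorem sub_aeval_apply_mem_krylov {b s : E} (hs : T s = -b) {q : ℝ[X]} {t : ℕ} (hq0 : q.eval 0 = 1)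
    (hqt : q.natDegree ≤ t) : s - aeval T q s ∈ krylov T b t := by
  have hdivX : s - aeval T q s = aeval T q.divX b := by
    conv_lhs => rw [← divX_mul_X_add q, coeff_zero_eq_eval_zero, hq0]
    simp only [map_add, map_mul, map_one, aeval_X, LinearMap.add_apply, Module.End.mul_apply, hs,
      map_neg, Module.End.one_apply]
    abel
  have hq : q ≠ 0 := fun h => by simp [h] at hq0
  rw [hdivX]
  exact aeval_mem_krylov T b ((degree_divX_lt hq).trans_le (natDegree_le_iff_degree_le.mp hqt))

theorem abs_mul_one_sub_sub_one_le {c z ε : ℝ} (hε : ε ≤ 1 / 3) (hz : |z| ≤ ε) (hc : 0 ≤ c)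
    (hlo : 1 ≤ c * (1 + ε)) (hhi : c * (1 - ε) ≤ 1) : |c * (1 - z) - 1| ≤ 3 * ε := by
  have hz' := abs_le.mp hz
  rw [abs_le]
  constructor <;> nlinarith

/- Rescaling `s - q(T) s` to the norm of `s` costs at most a factor `3` in the error. -/
theorem exists_norm_eq_inner_sub_le (h : HasSpectralBounds T l L) (hl : 0 ≤ l) {b s : E}
    (hs : T s = -b) {q : ℝ[X]} {t : ℕ} {ε : ℝ} (hq0 : q.eval 0 = 1) (hqt : q.natDegree ≤ t)
    (hq : ∀ z ∈ Set.Icc l L, |q.eval z| ≤ ε) (hε0 : 0 ≤ ε) (hε : ε ≤ 1 / 3) :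
    ∃ x ∈ krylov T b t, ‖x‖ = ‖s‖ ∧ ⟪x - s, T (x - s)⟫ ≤ (3 * ε) ^ 2 * ⟪s, T s⟫ := by
  rcases eq_or_ne s 0 with rfl | hs0
  · exact ⟨0, zero_mem _, rfl, by simp⟩
  have hsn : 0 < ‖s‖ := norm_pos_iff.mpr hs0
  set y := s - aeval T q s with hy
  have hqs : ‖aeval T q s‖ ≤ ε * ‖s‖ := h.norm_aeval_apply_le hε0 hq s
  have hylo : (1 - ε) * ‖s‖ ≤ ‖y‖ := by linarith [norm_sub_norm_le s (aeval T q s)]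
  have hyhi : ‖y‖ ≤ (1 + ε) * ‖s‖ := by linarith [norm_sub_le s (aeval T q s)]
  have hyn : 0 < ‖y‖ := (mul_pos (by linarith) hsn).trans_le hylo
  set c := ‖s‖ / ‖y‖ with hc
  have hclo : 1 ≤ c * (1 + ε) := by rwa [hc, div_mul_eq_mul_div, one_le_div hyn, mul_comm]
  have hchi : c * (1 - ε) ≤ 1 := by rwa [hc, div_mul_eq_mul_div, div_le_one hyn, mul_comm]
  have herror : c • y - s = aeval T (C c * (1 - q) - 1) s := by
    simp only [hy, smul_sub, map_sub, map_mul, aeval_C, map_one, LinearMap.sub_apply,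
      Module.End.mul_apply, Module.algebraMap_end_apply, Module.End.one_apply]
  have hpoly : ∀ z ∈ Set.Icc l L,
      (X * (C c * (1 - q) - 1) ^ 2).eval z ≤ (C ((3 * ε) ^ 2) * X).eval z := fun z hz => by
    have habs := abs_mul_one_sub_sub_one_le hε (hq z hz) (by positivity) hclo hchi
    have hsq := sq_le_sq' (abs_le.mp habs).1 (abs_le.mp habs).2
    simp only [eval_mul, eval_X, eval_pow, eval_sub, eval_C, eval_one]
    rw [mul_comm z]
    exact mul_le_mul_of_nonneg_right hsq (hl.trans hz.1)
  have hinner := h.inner_aeval_mono hpoly s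
  rw [inner_aeval_mul_sq h.isSymmetric, aeval_X, ← herror, map_mul, aeval_C, aeval_X,
    Module.End.mul_apply, Module.algebraMap_end_apply, real_inner_smul_right] at hinner
  exact ⟨c • y, Submodule.smul_mem _ _ (sub_aeval_apply_mem_krylov hs hq0 hqt),
    by rw [norm_smul, Real.norm_of_nonneg (by positivity), div_mul_cancel₀ _ hyn.ne'], hinner⟩

end LinearRate

section SphereRate

open Polynomial
open scoped RealInnerProductSpace

variable {E : Type*} [NormedAddCommGroup E] [InnerProductSpace ℝ E] {T : E →ₗ[ℝ] E} {l L : ℝ}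

theorem norm_sub_inner_smul_sq {w : E} (hw : ‖w‖ = 1) (b : E) :
    ‖b - ⟪w, b⟫ • w‖ ^ 2 = ‖b‖ ^ 2 - ⟪w, b⟫ ^ 2 := by
  rw [norm_sub_sq_real, norm_smul, hw, mul_one, Real.norm_eq_abs, sq_abs, real_inner_smul_right,
    real_inner_comm]
  ring

theorem inner_aeval_apply_of_apply_eq_smul (hT : T.IsSymmetric) {w : E} {μ : ℝ}
    (hTw : T w = μ • w) (p : ℝ[X]) (b : E) : ⟪w, aeval T p b⟫ = p.eval μ * ⟪w, b⟫ := by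
  rw [← isSymmetric_aeval hT p, Module.End.aeval_apply_of_mem_apply_eq_smul hTw,
    real_inner_smul_left]

theorem HasSpectralBounds.inner_aeval_le_of_apply_eq_smul (h : HasSpectralBounds T l L) {w : E}
    {μ : ℝ} (hw : ‖w‖ = 1) (hTw : T w = μ • w) {p : ℝ[X]} {m : ℝ}
    (hp : ∀ z ∈ Set.Icc l L, p.eval z ≤ m) (b : E) :
    ⟪b, aeval T p b⟫ ≤ p.eval μ * ⟪w, b⟫ ^ 2 + m * (‖b‖ ^ 2 - ⟪w, b⟫ ^ 2) := by
  set β := ⟪w, b⟫ with hβ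
  set b' := b - β • w with hb'
  have hpw : aeval T p w = p.eval μ • w := Module.End.aeval_apply_of_mem_apply_eq_smul hTw
  have horth : ⟪w, b'⟫ = 0 := by
    rw [hb', inner_sub_right, real_inner_smul_right, real_inner_self_eq_norm_sq, hw, ← hβ]
    ring
  have hsplit : ⟪b, aeval T p b⟫ = p.eval μ * β ^ 2 + ⟪b', aeval T p b'⟫ := by
    have hcross : ⟪w, aeval T p b'⟫ = 0 := by
      rw [inner_aeval_apply_of_apply_eq_smul h.isSymmetric hTw, horth, mul_zero]
    rw [show b = β • w + b' by rw [hb', add_sub_cancel], map_add, map_smul, hpw]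
    simp only [inner_add_left, inner_add_right, real_inner_smul_left, real_inner_smul_right,
      hcross, real_inner_comm w b', horth, real_inner_self_eq_norm_sq, hw]
    ring
  have hb'm := h.inner_aeval_mono (p := p) (q := C m) (fun z hz => by rw [eval_C]; exact hp z hz) b'
  rw [aeval_C, Module.algebraMap_end_apply, real_inner_smul_right, real_inner_self_eq_norm_sq,
    norm_sub_inner_smul_sq hw] at hb'm
  linarith

theorem inner_sq_le_norm_sq {w : E} (hw : ‖w‖ = 1) (b : E) : ⟪w, b⟫ ^ 2 ≤ ‖b‖ ^ 2 :=
  sub_nonneg.mp (norm_sub_inner_smul_sq hw b ▸ sq_nonneg _)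

theorem exists_inner_apply_le_of_exp (h : HasSpectralBounds T 0 L) (hL : 0 < L) {b w : E}
    (hw : ‖w‖ = 1) (hTw : T w = 0) (hwb : ⟪w, b⟫ ≠ 0) {n : ℕ} {r : ℝ} (hr0 : 0 < r) (hr1 : r < 1)
    (hr : 4 * ‖b‖ ^ 2 ≤ Real.exp ((4 * n + 2) * r) * ⟪w, b⟫ ^ 2) :
    ∃ z ∈ krylov T b (n + 1), z ≠ 0 ∧ ⟪z, T z⟫ ≤ L * r ^ 2 * ‖z‖ ^ 2 := by
  set δ := L * r ^ 2
  set τ := Real.exp ((4 * n + 2) * r) / 2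
  have hδL : δ < L := mul_lt_of_lt_one_right hL (pow_lt_one₀ hr0.le hr1 two_ne_zero)
  have hβ : 0 < ⟪w, b⟫ ^ 2 := by positivity
  have hτ1 : 1 < τ := by
    have hτ := le_of_mul_le_mul_right
      ((mul_le_mul_of_nonneg_left (inner_sq_le_norm_sq hw b) zero_le_four).trans hr) hβ
    simp only [τ]
    linarith
  have hτ : τ ≤ (Chebyshev.T ℝ (2 * n + 1)).eval ((L + δ) / (L - δ)) := by
    have hexp := half_exp_le_eval_T (by positivity : 0 ≤ δ) hδL (2 * n + 1)
    rw [mul_div_cancel_left₀ _ hL.ne', Real.sqrt_sq hr0.le] at hexp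
    convert hexp using 3 <;> push_cast <;> ring
  obtain ⟨P, hPdeg, hP0, hP⟩ := exists_sub_mul_eval_sq_le hδL n hτ
  have hP0ne : P.eval 0 ≠ 0 := fun h0 => by
    rw [h0] at hP0
    nlinarith
  have hPn : P.degree < (n + 1 : ℕ) :=
    (natDegree_le_iff_degree_le.mp hPdeg).trans_lt (by exact_mod_cast n.lt_succ_self)
  have hTw' : T w = (0 : ℝ) • w := hTw.trans (zero_smul ℝ w).symm
  refine ⟨aeval T P b, aeval_mem_krylov T b hPn, fun hz => ?_, ?_⟩
  · have hwz := inner_aeval_apply_of_apply_eq_smul h.isSymmetric hTw' P b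
    rw [hz, inner_zero_right] at hwz
    exact mul_ne_zero hP0ne hwb hwz.symm
  · have hform := h.inner_aeval_le_of_apply_eq_smul hw hTw' (p := (X - C δ) * P ^ 2) (m := L - δ)
      (fun z hz => by simpa only [eval_mul, eval_sub, eval_X, eval_C, eval_pow] using hP z hz) b
    rw [inner_aeval_mul_sq h.isSymmetric, map_sub, aeval_X, aeval_C, LinearMap.sub_apply,
      Module.algebraMap_end_apply, inner_sub_right, real_inner_smul_right,
      real_inner_self_eq_norm_sq, eval_mul, eval_sub, eval_X, eval_C, zero_sub, eval_pow] at hform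
    have hP0β := mul_le_mul_of_nonneg_right hP0 hβ.le
    have hbβ := mul_le_mul_of_nonneg_left hr (sub_pos.mpr hδL).le
    simp only [τ] at hP0β
    nlinarith

theorem exists_approx_null_vector (h : HasSpectralBounds T 0 L) {b w : E} (hw : ‖w‖ = 1)
    (hTw : T w = 0) (hwb : ⟪w, b⟫ ≠ 0) (n : ℕ) :
    ∃ z ∈ krylov T b (n + 1), z ≠ 0 ∧
      ⟪z, T z⟫ ≤ L * (Real.log (4 * ‖b‖ ^ 2 / ⟪w, b⟫ ^ 2) / (4 * n + 2)) ^ 2 * ‖z‖ ^ 2 := by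
  have hβ : 0 < ⟪w, b⟫ ^ 2 := by positivity
  have hL : 0 ≤ L := by simpa [hw, hTw] using h.upper w
  set W := 4 * ‖b‖ ^ 2 / ⟪w, b⟫ ^ 2 with hW
  have hW4 : 4 ≤ W := (le_div_iff₀ hβ).mpr (by linarith [inner_sq_le_norm_sq hw b])
  have hlog : 0 < Real.log W := Real.log_pos (by linarith)
  set r := Real.log W / (4 * n + 2) with hr
  by_cases htriv : 1 ≤ r ∨ L = 0
  · have hLr : L ≤ L * r ^ 2 := by
      rcases htriv with h1 | rfl
      · exact le_mul_of_one_le_right hL (one_le_pow₀ h1)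
      · rw [zero_mul]
    refine ⟨b, pow_apply_mem_krylov (i := 0) n.succ_pos, ?_, (h.upper b).trans (by gcongr)⟩
    rintro rfl
    exact hwb (inner_zero_right w)
  · push Not at htriv
    refine exists_inner_apply_le_of_exp h (hL.lt_of_ne' htriv.2) hw hTw hwb (by positivity)
      htriv.1 ?_
    rw [hr, mul_div_cancel₀ _ (by positivity), Real.exp_log (by linarith), hW,
      div_mul_cancel₀ _ hβ.ne']

theorem exists_nonneg_norm_add_smul_eq {y z : E} {R : ℝ} (hz : z ≠ 0) (hy : ‖y‖ ≤ R) :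
    ∃ α : ℝ, 0 ≤ α ∧ ‖y + α • z‖ = R := by
  have hR : 0 ≤ R := (norm_nonneg y).trans hy
  have hfar : R ≤ ‖y + (2 * R / ‖z‖) • z‖ := by
    have hnorm : ‖(2 * R / ‖z‖) • z‖ = 2 * R := by
      rw [norm_smul, Real.norm_of_nonneg (by positivity),
        div_mul_cancel₀ _ (norm_ne_zero_iff.mpr hz)]
    linarith [norm_le_add_norm_add' y ((2 * R / ‖z‖) • z)]
  obtain ⟨α, hα, hαR⟩ := intermediate_value_Icc (by positivity : 0 ≤ 2 * R / ‖z‖)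
    (by fun_prop : ContinuousOn (fun α : ℝ => ‖y + α • z‖) _) ⟨by simpa using hy, hfar⟩
  exact ⟨α, hα.1, hαR⟩

theorem exists_norm_add_smul_eq_mul_nonpos {y z : E} {R : ℝ} (hz : z ≠ 0) (hy : ‖y‖ ≤ R)
    (c : ℝ) : ∃ α : ℝ, ‖y + α • z‖ = R ∧ α * c ≤ 0 := by
  rcases le_total c 0 with hc | hc
  · obtain ⟨α, hα, hαR⟩ := exists_nonneg_norm_add_smul_eq hz hy
    exact ⟨α, hαR, mul_nonpos_of_nonneg_of_nonpos hα hc⟩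
  · obtain ⟨α, hα, hαR⟩ := exists_nonneg_norm_add_smul_eq (neg_ne_zero.mpr hz) hy
    exact ⟨-α, by simpa using hαR, mul_nonpos_of_nonpos_of_nonneg (by linarith) hc⟩

theorem exists_norm_add_smul_eq_quadraticModel_le (hT : T.IsSymmetric) (b : E) {y z : E} {R κ : ℝ}
    (hy : ‖y‖ ≤ R) (hz : z ≠ 0) (hκ : 0 ≤ κ) (hTz : ⟪z, T z⟫ ≤ κ * ‖z‖ ^ 2) :
    ∃ α : ℝ, ‖y + α • z‖ = R ∧
      quadraticModel T b (y + α • z) ≤ quadraticModel T b y + 2 * κ * R ^ 2 := by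
  obtain ⟨α, hαR, hα⟩ := exists_norm_add_smul_eq_mul_nonpos hz hy ⟪T y + b, z⟫
  refine ⟨α, hαR, ?_⟩
  have hαz : α ^ 2 * ‖z‖ ^ 2 ≤ (2 * R) ^ 2 := by
    have hnorm : ‖α • z‖ ≤ 2 * R := by
      have := norm_sub_le (y + α • z) y
      rw [add_sub_cancel_left] at this
      linarith
    rw [← sq_abs α, ← Real.norm_eq_abs, ← mul_pow, ← norm_smul]
    gcongr
  have hcurv : α ^ 2 * ⟪z, T z⟫ ≤ κ * (2 * R) ^ 2 := by
    calc α ^ 2 * ⟪z, T z⟫ ≤ α ^ 2 * (κ * ‖z‖ ^ 2) := by gcongr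
      _ = κ * (α ^ 2 * ‖z‖ ^ 2) := by ring
      _ ≤ κ * (2 * R) ^ 2 := by gcongr
  rw [quadraticModel_add hT, map_smul, real_inner_smul_left, real_inner_smul_right,
    real_inner_smul_right]
  linarith

theorem exists_sphere_approx (h : HasSpectralBounds T 0 L) {b w : E} (s : E) (hw : ‖w‖ = 1)
    (hTw : T w = 0) (hwb : ⟪w, b⟫ ≠ 0) (n : ℕ) :
    ∃ x ∈ krylov T b (n + 1), ‖x‖ = ‖s‖ ∧ quadraticModel T b x - quadraticModel T b s ≤
      2 * L * ‖s‖ ^ 2 / ((n + 1 : ℕ) : ℝ) ^ 2 +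
        2 * L * ‖s‖ ^ 2 * (Real.log (4 * ‖b‖ ^ 2 / ⟪w, b⟫ ^ 2) / (4 * n + 2)) ^ 2 := by
  have hL : 0 ≤ L := by simpa [hw, hTw] using h.upper w
  obtain ⟨y, hyK, hys, hy⟩ := exists_ball_approx h hL b s n.succ_pos
  obtain ⟨z, hzK, hz0, hz⟩ := exists_approx_null_vector h hw hTw hwb n
  obtain ⟨α, hαs, hα⟩ := exists_norm_add_smul_eq_quadraticModel_le h.isSymmetric b hys hz0
    (by positivity) hz
  exact ⟨y + α • z, add_mem hyK (Submodule.smul_mem _ _ hzK), hαs, by linarith⟩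

end SphereRate

section Optimality

open Filter Topology
open scoped RealInnerProductSpace

variable {E : Type*} [NormedAddCommGroup E] [InnerProductSpace ℝ E] {T : E →ₗ[ℝ] E} {b s : E}
  {R : ℝ}

theorem inner_gradient_nonneg_of_isMinOn (hT : T.IsSymmetric) {S : Set E} (hS : Convex ℝ S)
    (hs : s ∈ S) (hmin : IsMinOn (quadraticModel T b) S s) {x : E} (hx : x ∈ S) :
    0 ≤ ⟪T s + b, x - s⟫ := by
  have hpos : ∀ ε ∈ Set.Ioc (0 : ℝ) 1,
      0 ≤ ⟪T s + b, x - s⟫ + ε * (1 / 2 * ⟪x - s, T (x - s)⟫) := fun ε hε => by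
    have hle : quadraticModel T b s ≤ quadraticModel T b (s + ε • (x - s)) :=
      hmin (hS.add_smul_sub_mem hs hx ⟨hε.1.le, hε.2⟩)
    rw [quadraticModel_add hT, map_smul, real_inner_smul_left, real_inner_smul_right,
      real_inner_smul_right] at hle
    have hmul : 0 ≤ ε * (⟪T s + b, x - s⟫ + ε * (1 / 2 * ⟪x - s, T (x - s)⟫)) := by linarith
    exact nonneg_of_mul_nonneg_right hmul hε.1
  have hlim : Tendsto (fun ε : ℝ => ⟪T s + b, x - s⟫ + ε * (1 / 2 * ⟪x - s, T (x - s)⟫))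
      (𝓝[>] 0) (𝓝 ⟪T s + b, x - s⟫) :=
    ((by fun_prop : Continuous _).tendsto' 0 _ (by rw [zero_mul, add_zero])).mono_left
      nhdsWithin_le_nhds
  exact ge_of_tendsto hlim (mem_of_superset (Ioc_mem_nhdsGT one_pos) hpos)

/- Testing the variational inequality at `-(R / ‖g‖) • g` forces equality in the Cauchy–Schwarz
inequality for `g` and `s`, so the multiplier is `‖g‖ / R`. -/
theorem exists_nonneg_add_smul_eq_zero (hR : 0 < R) (hs : ‖s‖ ≤ R) {g : E}
    (hg : ∀ x : E, ‖x‖ ≤ R → 0 ≤ ⟪g, x - s⟫) :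
    ∃ lam : ℝ, 0 ≤ lam ∧ g + lam • s = 0 ∧ lam * (R - ‖s‖) = 0 := by
  obtain ⟨c, hcR, hc⟩ := exists_smul_norm_le_inner_eq hR.le g
  have hgs : ‖g‖ * R ≤ -⟪g, s⟫ := by
    have := hg _ hcR
    rw [inner_sub_right, hc] at this
    linarith
  have hlam : ‖g‖ / R * R = ‖g‖ := div_mul_cancel₀ _ hR.ne'
  refine ⟨‖g‖ / R, by positivity, ?_, ?_⟩
  · have hlams : ‖g‖ / R * ‖s‖ ≤ ‖g‖ := by
      calc ‖g‖ / R * ‖s‖ ≤ ‖g‖ / R * R := by gcongr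
        _ = ‖g‖ := hlam
    have hlamgs : ‖g‖ ^ 2 ≤ ‖g‖ / R * -⟪g, s⟫ := by
      calc ‖g‖ ^ 2 = ‖g‖ / R * (‖g‖ * R) := by rw [mul_left_comm, hlam, sq]
        _ ≤ ‖g‖ / R * -⟪g, s⟫ := by gcongr
    have hsq : ‖g + (‖g‖ / R) • s‖ ^ 2 ≤ 0 := by
      rw [norm_add_sq_real, real_inner_smul_right, norm_smul, Real.norm_of_nonneg (by positivity)]
      have := pow_le_pow_left₀ (by positivity) hlams 2
      linarith
    exact norm_eq_zero.mp (pow_eq_zero_iff two_ne_zero |>.mp (hsq.antisymm (sq_nonneg _)))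
  · have hle : ‖g‖ * (R - ‖s‖) ≤ 0 := by
      linarith [neg_le_of_abs_le (abs_real_inner_le_norm g s)]
    rw [div_mul_eq_mul_div, hle.antisymm (mul_nonneg (norm_nonneg g) (sub_nonneg.mpr hs)), zero_div]

theorem inner_apply_nonneg_of_inner_ne_zero {M : E →ₗ[ℝ] E}
    (hM : ∀ x : E, ‖x‖ = ‖s‖ → 0 ≤ ⟪x - s, M (x - s)⟫) {w : E} (hw : ⟪s, w⟫ ≠ 0) :
    0 ≤ ⟪w, M w⟫ := by
  have hw0 : w ≠ 0 := by
    rintro rfl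
    exact hw (inner_zero_right s)
  have hwn : ‖w‖ ^ 2 ≠ 0 := by positivity
  set α := -(2 * ⟪s, w⟫) / ‖w‖ ^ 2
  have hα : α ≠ 0 := div_ne_zero (neg_ne_zero.mpr (mul_ne_zero two_ne_zero hw)) hwn
  have hαw : α * ‖w‖ ^ 2 = -(2 * ⟪s, w⟫) := div_mul_cancel₀ _ hwn
  have hnorm : ‖s + α • w‖ = ‖s‖ := by
    rw [← sq_eq_sq₀ (norm_nonneg _) (norm_nonneg _), norm_add_sq_real, norm_smul,
      real_inner_smul_right, mul_pow, Real.norm_eq_abs, sq_abs]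
    linear_combination α * hαw
  have hcurv := hM _ hnorm
  rw [add_sub_cancel_left, map_smul, real_inner_smul_left, real_inner_smul_right,
    ← mul_assoc] at hcurv
  exact nonneg_of_mul_nonneg_right hcurv (mul_self_pos.mpr hα)

theorem inner_apply_nonneg_of_forall_norm_eq (hs : s ≠ 0) {M : E →ₗ[ℝ] E}
    (hM : ∀ x : E, ‖x‖ = ‖s‖ → 0 ≤ ⟪x - s, M (x - s)⟫) (w : E) : 0 ≤ ⟪w, M w⟫ := by
  rcases ne_or_eq ⟪s, w⟫ 0 with hsw | hsw
  · exact inner_apply_nonneg_of_inner_ne_zero hM hsw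
  have hpos : ∀ ε ∈ Set.Ioi (0 : ℝ), 0 ≤ ⟪w + ε • s, M w + ε • M s⟫ := fun ε hε => by
    rw [← map_smul, ← map_add]
    refine inner_apply_nonneg_of_inner_ne_zero hM ?_
    rw [inner_add_right, hsw, zero_add, real_inner_smul_right]
    exact mul_ne_zero hε.ne' (inner_self_ne_zero.mpr hs)
  have hlim : Tendsto (fun ε : ℝ => ⟪w + ε • s, M w + ε • M s⟫) (𝓝[>] 0) (𝓝 ⟪w, M w⟫) :=
    ((by fun_prop : Continuous _).tendsto' 0 _ (by simp only [zero_smul, add_zero])).mono_left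
      nhdsWithin_le_nhds
  exact ge_of_tendsto hlim (mem_of_superset self_mem_nhdsWithin hpos)

theorem inner_shift_apply_nonneg_of_isMinOn (hT : T.IsSymmetric) (hR : 0 < R) (hs : ‖s‖ ≤ R)
    (hmin : IsMinOn (quadraticModel T b) {x | ‖x‖ ≤ R} s) {lam : ℝ}
    (hstat : T s + lam • s + b = 0) (hcompl : lam * (R - ‖s‖) = 0) (w : E) :
    0 ≤ ⟪w, shift T lam w⟫ := by
  have hM {x : E} (hx : ‖x‖ ≤ R) (hlam : lam * (‖s‖ ^ 2 - ‖x‖ ^ 2) = 0) :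
      0 ≤ ⟪x - s, shift T lam (x - s)⟫ := by
    have hle : quadraticModel T b s ≤ quadraticModel T b x := hmin hx
    linarith [quadraticModel_sub_eq hT hstat x]
  rcases eq_or_ne s 0 with rfl | hs0
  · rw [norm_zero, sub_zero] at hcompl
    rcases eq_or_ne w 0 with rfl | hw
    · rw [inner_zero_left]
    have hwn : ‖w‖ ≠ 0 := norm_ne_zero_iff.mpr hw
    have hball := hM (x := (R / ‖w‖) • w)
      (by rw [norm_smul, Real.norm_of_nonneg (by positivity), div_mul_cancel₀ _ hwn])
      (by rw [(mul_eq_zero_iff_right hR.ne').mp hcompl, zero_mul])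
    rw [sub_zero, map_smul, real_inner_smul_left, real_inner_smul_right, ← mul_assoc] at hball
    exact nonneg_of_mul_nonneg_right hball (by positivity)
  · exact inner_apply_nonneg_of_forall_norm_eq hs0
      (fun x hx => hM (hx.le.trans hs) (by rw [hx, sub_self, mul_zero])) w

/-- `lam` is a Lagrange multiplier at `s` for minimizing `quadraticModel T b` over the centred ball
of radius `R`, where `l` stands for the smallest eigenvalue of `T`. -/
def IsBallMultiplier (T : E →ₗ[ℝ] E) (b : E) (R l : ℝ) (s : E) (lam : ℝ) : Prop :=
  T s + lam • s + b = 0 ∧ max (-l) 0 ≤ lam ∧ lam * (R - ‖s‖) = 0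

theorem existsUnique_isBallMultiplier (hT : T.IsSymmetric) (hR : 0 < R) (hs : ‖s‖ ≤ R)
    (hmin : IsMinOn (quadraticModel T b) {x | ‖x‖ ≤ R} s) {v : E} {l : ℝ} (hv : ‖v‖ = 1)
    (hTv : T v = l • v) : ∃! lam : ℝ, IsBallMultiplier T b R l s lam := by
  have hconvex : Convex ℝ {x : E | ‖x‖ ≤ R} := by
    simpa only [Metric.closedBall, dist_zero_right] using convex_closedBall (0 : E) R
  obtain ⟨lam, hlam, hgrad, hcompl⟩ := exists_nonneg_add_smul_eq_zero hR hs fun x hx =>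
    inner_gradient_nonneg_of_isMinOn hT hconvex hs hmin hx
  have hstat : T s + lam • s + b = 0 := by rwa [add_right_comm]
  have hl : 0 ≤ l + lam := by
    have hcurv := inner_shift_apply_nonneg_of_isMinOn hT hR hs hmin hstat hcompl v
    rwa [inner_shift_apply, hTv, real_inner_smul_right, real_inner_self_eq_norm_sq, hv, one_pow,
      mul_one, mul_one] at hcurv
  refine ⟨lam, ⟨hstat, max_le (by linarith) hlam, hcompl⟩, fun lam' ⟨hstat', _, hcompl'⟩ => ?_⟩
  rcases eq_or_ne s 0 with rfl | hs0
  · rw [norm_zero, sub_zero] at hcompl hcompl'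
    exact mul_right_cancel₀ hR.ne' (hcompl'.trans hcompl.symm)
  · exact smul_left_injective ℝ hs0 (add_left_cancel (add_right_cancel (hstat'.trans hstat.symm)))

end Optimality

section KrylovRates

open scoped RealInnerProductSpace

variable {E : Type*} [NormedAddCommGroup E] [InnerProductSpace ℝ E] {T : E →ₗ[ℝ] E} {b s x : E}
  {R l L : ℝ} {t : ℕ}

theorem quadraticModel_zero_sub_eq (hT : T.IsSymmetric) {lam : ℝ}
    (hstat : T s + lam • s + b = 0) :
    quadraticModel T b 0 - quadraticModel T b s =
      1 / 2 * ⟪s, shift T lam s⟫ + lam / 2 * ‖s‖ ^ 2 := by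
  rw [quadraticModel_sub_eq hT hstat, zero_sub, map_neg, inner_neg_neg, norm_zero,
    zero_pow two_ne_zero, sub_zero]

theorem exists_krylov_linear_approx (h : HasSpectralBounds T l L) {lam : ℝ} (hlL : l ≤ L)
    (hl : 0 < l + lam) (hlam : 0 ≤ lam) (hstat : T s + lam • s + b = 0) (ht : 0 < t) {ε : ℝ}
    (hε : 2 * Real.exp (-2 * t * √((l + lam) / (L + lam))) = ε) (hsmall : ε ≤ 1 / 3) :
    ∃ y ∈ krylov T b t, ‖y‖ = ‖s‖ ∧ quadraticModel T b y - quadraticModel T b s ≤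
      (3 * ε) ^ 2 * (quadraticModel T b 0 - quadraticModel T b s) := by
  have hM := hasSpectralBounds_shift h lam
  have hMs : shift T lam s = -b := by rw [shift_apply, eq_neg_iff_add_eq_zero, hstat]
  have hlL' : l + lam ≤ L + lam := by linarith
  have hε0 : 0 ≤ ε := hε ▸ by positivity
  obtain ⟨q, hqt, hq0, hq⟩ := exists_eval_zero_eq_one_abs_eval_le hl hlL' ht
  obtain ⟨y, hy, hys, hyM⟩ :=
    exists_norm_eq_inner_sub_le hM hl.le hMs hq0 hqt (hε ▸ hq) hε0 hsmall
  refine ⟨y, krylov_shift_le T b lam t hy, hys, ?_⟩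
  have hlams : 0 ≤ (3 * ε) ^ 2 * (lam / 2 * ‖s‖ ^ 2) := by positivity
  rw [quadraticModel_zero_sub_eq h.isSymmetric hstat, quadraticModel_sub_eq h.isSymmetric hstat,
    hys, sub_self, mul_zero, add_zero]
  linarith

theorem krylov_linear_rate (h : HasSpectralBounds T l L) {lam : ℝ} (hlL : l ≤ L)
    (hlam : max (-l) 0 ≤ lam) (hstat : T s + lam • s + b = 0) (hs : ‖s‖ ≤ R)
    (hx : IsMinOn (quadraticModel T b) {y | y ∈ krylov T b t ∧ ‖y‖ ≤ R} x) :
    quadraticModel T b x - quadraticModel T b s ≤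
      36 * (quadraticModel T b 0 - quadraticModel T b s) *
        Real.exp (-4 * t * √((l + lam) / (L + lam))) := by
  have hlam0 : 0 ≤ lam := (le_max_right _ _).trans hlam
  have hl : 0 ≤ l + lam := by linarith [(le_max_left (-l) 0).trans hlam]
  set r := √((l + lam) / (L + lam)) with hr
  set ε := 2 * Real.exp (-2 * t * r) with hε
  have hε_sq : 36 * Real.exp (-4 * t * r) = (3 * ε) ^ 2 := by
    rw [hε, mul_pow, mul_pow, ← Real.exp_nat_mul]
    ring_nf
  rw [mul_right_comm, hε_sq]
  rcases le_or_gt ε (1 / 3) with hsmall | hlarge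
  · have ht : t ≠ 0 := by
      rintro rfl
      norm_num [hε] at hsmall
    have hl0 : l + lam ≠ 0 := fun h0 => by norm_num [hε, hr, h0] at hsmall
    obtain ⟨y, hy, hys, hgap⟩ := exists_krylov_linear_approx h hlL (hl.lt_of_ne' hl0) hlam0 hstat
      (Nat.pos_of_ne_zero ht) hε.symm hsmall
    have hxy : quadraticModel T b x ≤ quadraticModel T b y := hx ⟨hy, hys.trans_le hs⟩
    linarith
  · have hgap : 0 ≤ quadraticModel T b 0 - quadraticModel T b s := by
      have := (mul_nonneg hl (sq_nonneg ‖s‖)).trans ((hasSpectralBounds_shift h lam).lower s)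
      rw [quadraticModel_zero_sub_eq h.isSymmetric hstat]
      positivity
    have hx0 : quadraticModel T b x ≤ quadraticModel T b 0 :=
      hx ⟨zero_mem _, norm_zero.trans_le ((norm_nonneg s).trans hs)⟩
    linarith [le_mul_of_one_le_left hgap (one_le_pow₀ (by linarith : 1 ≤ 3 * ε) (n := 2))]

theorem krylov_sublinear_rate_of_nonneg (h : HasSpectralBounds T l L) (hlL : l ≤ L) (hl : 0 ≤ l)
    (hs : ‖s‖ ≤ R) (ht : 0 < t)
    (hx : IsMinOn (quadraticModel T b) {y | y ∈ krylov T b t ∧ ‖y‖ ≤ R} x) :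
    quadraticModel T b x - quadraticModel T b s ≤ 2 * (L - l) * ‖s‖ ^ 2 / (t : ℝ) ^ 2 := by
  have h0 := hasSpectralBounds_shift h (-l)
  rw [add_neg_cancel, ← sub_eq_add_neg] at h0
  obtain ⟨y, hy, hys, hgap⟩ := exists_ball_approx h0 (sub_nonneg.mpr hlL) b s ht
  have hxy : quadraticModel T b x ≤ quadraticModel T b y :=
    hx ⟨krylov_shift_le T b (-l) t hy, hys.trans hs⟩
  have hnorm : l * ‖y‖ ^ 2 ≤ l * ‖s‖ ^ 2 := by gcongr
  rw [quadraticModel_shift, quadraticModel_shift] at hgap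
  linarith

theorem krylov_sublinear_rate_of_inner_ne_zero (h : HasSpectralBounds T l L) {v : E} (hv : ‖v‖ = 1)
    (hTv : T v = l • v) (hvb : ⟪v, b⟫ ≠ 0) (hs : ‖s‖ ≤ R) (n : ℕ)
    (hx : IsMinOn (quadraticModel T b) {y | y ∈ krylov T b (n + 1) ∧ ‖y‖ ≤ R} x) :
    quadraticModel T b x - quadraticModel T b s ≤
      2 * (L - l) * ‖s‖ ^ 2 / ((n + 1 : ℕ) : ℝ) ^ 2 +
        2 * (L - l) * ‖s‖ ^ 2 * (Real.log (4 * ‖b‖ ^ 2 / ⟪v, b⟫ ^ 2) / (4 * n + 2)) ^ 2 := by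
  have h0 := hasSpectralBounds_shift h (-l)
  rw [add_neg_cancel, ← sub_eq_add_neg] at h0
  obtain ⟨y, hy, hys, hgap⟩ := exists_sphere_approx h0 s hv
    (by rw [shift_apply, hTv, neg_smul, add_neg_cancel]) hvb n
  have hxy : quadraticModel T b x ≤ quadraticModel T b y :=
    hx ⟨krylov_shift_le T b (-l) _ hy, hys.trans_le hs⟩
  rw [quadraticModel_shift, quadraticModel_shift, hys] at hgap
  linarith

theorem krylov_sublinear_rate (h : HasSpectralBounds T l L) {v : E} (hv : ‖v‖ = 1)
    (hTv : T v = l • v) (hvb : l < 0 → ⟪v, b⟫ ≠ 0) (hs : ‖s‖ ≤ R) (ht : 0 < t)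
    (hx : IsMinOn (quadraticModel T b) {y | y ∈ krylov T b t ∧ ‖y‖ ≤ R} x) :
    quadraticModel T b x - quadraticModel T b s ≤
      (L - l) * ‖s‖ ^ 2 / ((t : ℝ) - 1 / 2) ^ 2 *
        (4 + (if l < 0 then (1 : ℝ) else 0) / 8 *
          Real.log (4 * ‖b‖ ^ 2 / ⟪v, b⟫ ^ 2) ^ 2) := by
  have hlL : l ≤ L := by
    simpa only [hv, one_pow, mul_one] using (h.lower v).trans (h.upper v)
  obtain ⟨n, rfl⟩ := Nat.exists_eq_add_one_of_ne_zero ht.ne'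
  have hK : 0 ≤ (L - l) * ‖s‖ ^ 2 := mul_nonneg (sub_nonneg.mpr hlL) (sq_nonneg _)
  have hn : ((n + 1 : ℕ) : ℝ) - 1 / 2 = n + 1 / 2 := by push_cast; ring
  have hbase : 2 * (L - l) * ‖s‖ ^ 2 / ((n + 1 : ℕ) : ℝ) ^ 2 ≤
      (L - l) * ‖s‖ ^ 2 / ((n : ℝ) + 1 / 2) ^ 2 * 4 := by
    calc 2 * (L - l) * ‖s‖ ^ 2 / ((n + 1 : ℕ) : ℝ) ^ 2
        ≤ 2 * (L - l) * ‖s‖ ^ 2 / ((n : ℝ) + 1 / 2) ^ 2 := by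
          rw [mul_assoc]; gcongr; push_cast; linarith
      _ ≤ (L - l) * ‖s‖ ^ 2 / ((n : ℝ) + 1 / 2) ^ 2 * 4 := by
          rw [mul_assoc, mul_div_assoc]
          linarith [div_nonneg hK (sq_nonneg ((n : ℝ) + 1 / 2))]
  rw [hn, mul_add]
  split_ifs with hl
  · refine (krylov_sublinear_rate_of_inner_ne_zero h hv hTv (hvb hl) hs n hx).trans
      (add_le_add hbase (le_of_eq ?_))
    field_simp
    ring
  · simpa using (krylov_sublinear_rate_of_nonneg h hlL (not_lt.mp hl) hs ht hx).trans hbase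

theorem theorem4p1_general (h : HasSpectralBounds T l L) (hR : 0 < R) (hs : ‖s‖ ≤ R)
    (hmin : IsMinOn (quadraticModel T b) {x | ‖x‖ ≤ R} s) {v : E} (hv : ‖v‖ = 1)
    (hTv : T v = l • v) :
    (∃! lam : ℝ, IsBallMultiplier T b R l s lam) ∧
    ∀ t : ℕ, 0 < t → ∀ x : E, IsMinOn (quadraticModel T b) {y | y ∈ krylov T b t ∧ ‖y‖ ≤ R} x →
      (∀ lam : ℝ, IsBallMultiplier T b R l s lam →
        quadraticModel T b x - quadraticModel T b s ≤
          36 * (quadraticModel T b 0 - quadraticModel T b s) *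
            Real.exp (-4 * (t : ℝ) * √((l + lam) / (L + lam)))) ∧
      ((l < 0 → ⟪v, b⟫ ≠ 0) →
        quadraticModel T b x - quadraticModel T b s ≤
          (L - l) * ‖s‖ ^ 2 / ((t : ℝ) - 1 / 2) ^ 2 *
            (4 + (if l < 0 then (1 : ℝ) else 0) / 8 *
              Real.log (4 * ‖b‖ ^ 2 / ⟪v, b⟫ ^ 2) ^ 2)) := by
  have hlL : l ≤ L := by
    simpa only [hv, one_pow, mul_one] using (h.lower v).trans (h.upper v)
  exact ⟨existsUnique_isBallMultiplier h.isSymmetric hR hs hmin hv hTv, fun t ht x hx =>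
    ⟨fun lam ⟨hstat, hlam, _⟩ => krylov_linear_rate h hlL hlam hstat hs hx,
      fun hvb => krylov_sublinear_rate h hv hTv hvb hs ht hx⟩⟩

end KrylovRates

section Matrix

open Polynomial

variable {d : ℕ} {A : Matrix (Fin d) (Fin d) ℝ}

theorem hasSpectralBounds_toEuclideanLin (hA : A.IsSymm) :
    HasSpectralBounds A.toEuclideanLin (lambdaMin A) (lambdaMax A) := by
  have hT : A.toEuclideanLin.IsSymmetric := Matrix.isSymmetric_toEuclideanLin_iff.mpr hA
  have hmem {μ : ℝ} (hμ : Module.End.HasEigenvalue A.toEuclideanLin μ) : μ ∈ spectrum ℝ A := by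
    rwa [← Matrix.spectrum_toLpLin (p := 2), ← Module.End.hasEigenvalue_iff_mem_spectrum]
  have hlower := inner_aeval_nonneg_of_forall_hasEigenvalue hT (p := X - C (lambdaMin A))
    fun μ hμ => by
      simpa [lambdaMin] using csInf_le A.finite_real_spectrum.bddBelow (hmem hμ)
  have hupper := inner_aeval_nonneg_of_forall_hasEigenvalue hT (p := C (lambdaMax A) - X)
    fun μ hμ => by
      simpa [lambdaMax] using le_csSup A.finite_real_spectrum.bddAbove (hmem hμ)
  simp only [map_sub, aeval_X, aeval_C, LinearMap.sub_apply, Module.algebraMap_end_apply,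
    inner_sub_right, real_inner_smul_right, real_inner_self_eq_norm_sq, sub_nonneg] at hlower hupper
  exact ⟨hT, hlower, hupper⟩

theorem krylovSpace_eq_krylov (A : Matrix (Fin d) (Fin d) ℝ) (b : EuclideanSpace ℝ (Fin d))
    (t : ℕ) : krylovSpace A b t = krylov A.toEuclideanLin b t := by
  simp only [krylovSpace, krylov, Matrix.toLpLin_pow]

end Matrix

theorem theorem4p1 {d : ℕ} (hd : 0 < d) (A : Matrix (Fin d) (Fin d) ℝ) (hA : A.IsSymm)
    (b : EuclideanSpace ℝ (Fin d)) (R : ℝ) (hR : 0 < R)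
    (s : EuclideanSpace ℝ (Fin d)) (hs : IsTRSolution A b R s)
    (v : EuclideanSpace ℝ (Fin d)) (hv : ‖v‖ = 1) (hvA : A.toEuclideanLin v = lambdaMin A • v) :
    (∃! lam : ℝ, IsTRMultiplier A b R s lam) ∧
    ∀ t : ℕ, 0 < t → ∀ x : EuclideanSpace ℝ (Fin d), IsKrylovTRSolution A b R t x →
      (∀ lam : ℝ, IsTRMultiplier A b R s lam →
        quadObj A b x - quadObj A b s ≤
          36 * (quadObj A b 0 - quadObj A b s) *
            Real.exp (-4 * (t : ℝ) * √((lambdaMin A + lam) / (lambdaMax A + lam)))) ∧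
      ((lambdaMin A < 0 → inner ℝ v b ≠ 0) →
        quadObj A b x - quadObj A b s ≤
          (lambdaMax A - lambdaMin A) * ‖s‖ ^ 2 / ((t : ℝ) - 1 / 2) ^ 2 *
            (4 + (if lambdaMin A < 0 then (1 : ℝ) else 0) / 8 *
              Real.log (4 * ‖b‖ ^ 2 / (inner ℝ v b) ^ 2) ^ 2)) := by
  obtain ⟨hunique, hrates⟩ :=
    theorem4p1_general (hasSpectralBounds_toEuclideanLin hA) hR hs.1 hs.2 hv hvA
  refine ⟨hunique, fun t ht x hx => hrates t ht x ?_⟩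
  rw [← krylovSpace_eq_krylov]
  exact hx.2
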